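/- **Setting.** Let $T$ be a tree with vertex set $V$ and geodesic distance $d$, and let $(g_n)_{n\ge 0}$ be a half-infinite geodesic in $T$, with origin $o=g_0$, whose boundary point is taken as the root of $T$ at infinity. For $x\in V$ let $\Pi(x)$ be the vertex of this geodesic nearest to $x$, and let $\ell(x)=d(o,\Pi(x))-d(\Pi(x),x)$ be the level of $x$. Write $x\le y$ if $\ell(y)-\ell(x)=d(x,y)$, and let $s(x)$ be the set of neighbours $y$ of $x$ with $\ell(y)=\ell(x)-1$. Let $m:V\to(0,\infty)$ be a flow, i.e. $m(x)=\sum_{y\in s(x)}m(y)$ for all $x\in V$, and put $m(A)=\sum_{x\in A}m(x)$, $\int_A f\,dm=\sum_{x\in A}f(x)m(x)$. Assume that $m$ is locally doubling: for every integer $r>0$ there is $C_r>1$ such that $m(B_{2r}(x))\le C_r\,m(B_r(x))$ for all $x\in V$, where $B_r(x)=\{y: d(x,y)\le r\}$. Fix $\beta\ge 12$, and let $\mathcal R$ be the family of admissible trapezoids: all singletons $\{x\}$, $x \in V$, and all sets $\{y\in V:\ y\le x,\ \ell(x)-h''<\ell(y)\le \ell(x)-h'\}$ with $x\in V$ and integers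 $h''>h'\ge 1$ such that $2\le h''/h'\le\beta$. For $f:V\to\mathbb C$ put $f_R=\frac1{m(R)}\int_R f\,dm$ and $$\|f\|_{BMO}=\sup_{R\in\mathcal R}\frac1{m(R)}\int_R|f-f_R|\,dm ;$$ $BMO(m)$ consists of the $f$ with $\|f\|_{BMO}<\infty$, where functions that differ by a constant are identified. An atom is a function $a:V\to\mathbb C$ supported in some $R\in\mathcal R$ with $\|a\|_\infty\le m(R)^{-1}$ and $\int_R a\,dm=0$. The space $H^1(m)$ consists of all $g\in L^1(m)$ of the form $g=\sum_j\lambda_ja_j$ with atoms $a_j$ and $\lambda_j\in\mathbb C$, $\sum_j|\lambda_j|<\infty$; $\|g\|_{H^1}$ is the infimum of $\sum_j|\lambda_j|$ over all such representations. $H^1_{\mathrm{fin}}(m)$ is the subspace of finite linear combinations of atoms, and $\|\ell\|_{(H^1)'}$ is the operator norm of a bounded linear functional $\ell:H^1(m)\to\mathbb C$. **Theorem (Duality between $H^1(m)$ and $BMO(m)$).** The subspace $H^1_{\mathrm{fin}}(m)$ is dense in $H^1(m)$, and the following hold. (i) There is a constant $C>0$ such that for every $f\in BMO(m)$ the linear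 functional $\ell(g)=\int_V fg\,dm$, $g\in H^1_{\mathrm{fin}}(m)$, has a unique bounded extension $\ell$ to $H^1(m)$, and $\|\ell\|_{(H^1)'}\le C\|f\|_{BMO}$. (ii) There is a constant $C>0$ such that for every bounded linear functional $\ell$ on $H^1(m)$ there is $f\in BMO(m)$ with $\ell(g)=\int_V fg\,dm$ for all $g\in H^1_{\mathrm{fin}}(m)$ and $\|f\|_{BMO}\le C\|\ell\|_{(H^1)'}$. -/

import Mathlib

open scoped ENNReal

/-- A tree with root at infinity: a tree on the vertex set `V` together with a distinguished
half-infinite geodesic `ray`, which starts at the origin `o = ray 0` and whose boundary point is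
the root. -/
structure InfinityRootedTree (V : Type*) where
  graph : SimpleGraph V
  isTree : graph.IsTree
  ray : ℕ → V
  ray_geodesic : ∀ i j : ℕ, (graph.dist (ray i) (ray j) : ℤ) = |(i : ℤ) - (j : ℤ)|

namespace InfinityRootedTree

variable {V : Type*} (T : InfinityRootedTree V)

/-- The index `n` for which `ray n` is the projection of `x` on the ray, that is, the vertex of
the ray nearest to `x`. -/
noncomputable def projIndex (x : V) : ℕ :=
  Function.argmin (fun n : ℕ => T.graph.dist (T.ray n) x)

/-- The level `ℓ(x) = d(o, Π x) - d(Π x, x)`, where `Π x` is the projection of `x` on the ray. -/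
noncomputable def level (x : V) : ℤ :=
  (T.graph.dist (T.ray 0) (T.ray (T.projIndex x)) : ℤ)
    - (T.graph.dist (T.ray (T.projIndex x)) x : ℤ)

/-- The order relation `x ≤ y`: `y` lies between `x` and the root at infinity. -/
def Below (x y : V) : Prop :=
  T.level y - T.level x = (T.graph.dist x y : ℤ)

/-- The sons of `x`: the neighbours of `x` one level below `x`. -/
def sons (x : V) : Set V :=
  {y | T.graph.Adj x y ∧ T.level y = T.level x - 1}

/-- The ball `B_r(x)` of the geodesic distance. -/
def ball (x : V) (r : ℕ) : Set V :=
  {y | T.graph.dist y x ≤ r}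

/-- The trapezoid with root `x`, consisting of the vertices `y ≤ x` with
`ℓ(x) - h'' < ℓ(y) ≤ ℓ(x) - h'`. -/
def trapezoid (x : V) (h' h'' : ℕ) : Set V :=
  {y | T.Below y x ∧ T.level x - h'' < T.level y ∧ T.level y ≤ T.level x - h'}

/-- The admissible trapezoids with parameter `β`: the singletons, and the trapezoids with
`1 ≤ h' < h''` and `2 ≤ h'' / h' ≤ β`. -/
def IsAdmissible (β : ℝ) (R : Set V) : Prop :=
  (∃ x, R = {x}) ∨
    ∃ (x : V) (h' h'' : ℕ), 1 ≤ h' ∧ h' < h'' ∧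
      2 ≤ (h'' : ℝ) / (h' : ℝ) ∧ (h'' : ℝ) / (h' : ℝ) ≤ β ∧ R = T.trapezoid x h' h''

end InfinityRootedTree

/-- The measure `m(A) = ∑_{x ∈ A} m(x)` of a set of vertices. -/
noncomputable def vertexMass {V : Type*} (m : V → ℝ) (A : Set V) : ℝ≥0∞ :=
  ∑' x : A, ENNReal.ofReal (m x)

/-- A tree with root at infinity, endowed with a (strictly positive) locally doubling flow
measure `m`. -/
structure FlowTree (V : Type*) extends InfinityRootedTree V where
  m : V → ℝ
  m_pos : ∀ x, 0 < m x
  flow : ∀ x, HasSum (fun y : toInfinityRootedTree.sons x => m y) (m x)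
  locally_doubling : ∀ r : ℕ, 0 < r → ∃ C : ℝ, 1 < C ∧ ∀ x : V,
    vertexMass m (toInfinityRootedTree.ball x (2 * r))
      ≤ ENNReal.ofReal C * vertexMass m (toInfinityRootedTree.ball x r)

namespace FlowTree

variable {V : Type*} (T : FlowTree V) (β : ℝ)

/-- The measure `m(A)` of a set as a real number (used for sets of finite measure). -/
noncomputable def mass (A : Set V) : ℝ :=
  (vertexMass T.m A).toReal

/-- The integral `∫_A f dm = ∑_{x ∈ A} f(x) m(x)`. -/
noncomputable def integralOn {E : Type*} [NormedAddCommGroup E] [NormedSpace ℝ E]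
    (A : Set V) (f : V → E) : E :=
  ∑' x : A, T.m x • f x

/-- The average `f_R` of `f` over `R`. -/
noncomputable def average (R : Set V) (f : V → ℂ) : ℂ :=
  (T.mass R)⁻¹ • T.integralOn R f

/-- The `BMO` seminorm, the supremum over all admissible trapezoids `R` of
`m(R)⁻¹ ∫_R |f - f_R| dm`. -/
noncomputable def bmoNorm (f : V → ℂ) : ℝ≥0∞ :=
  ⨆ (R : Set V) (_ : T.IsAdmissible β R),
    ENNReal.ofReal ((T.mass R)⁻¹ * T.integralOn R (fun x => ‖f x - T.average R f‖))

/-- `f` is (a representative modulo constants of) an element of `BMO(m)`. -/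
def MemBMO (f : V → ℂ) : Prop :=
  T.bmoNorm β f < ∞

/-- `(1,∞)`-atoms: functions that are supported in an admissible trapezoid `R`, bounded by
`m(R)⁻¹`, and have vanishing integral. -/
def IsAtom (a : V → ℂ) : Prop :=
  ∃ R : Set V, T.IsAdmissible β R ∧ (∀ x, x ∉ R → a x = 0) ∧
    (∀ x, ‖a x‖ ≤ (T.mass R)⁻¹) ∧ T.integralOn R a = 0

/-- `g = ∑_j c_j a_j` with `(1,∞)`-atoms `a_j` and `∑_j |c_j| < ∞`. Since the atoms satisfy
`‖a_j‖_1 ≤ 1` and `|a_j(x)| ≤ m(x)⁻¹`, the series converges absolutely both in `L¹(m)` and at every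
vertex, so that its sum in `L¹(m)` is its pointwise sum. -/
structure IsAtomicDecomposition (g : V → ℂ) (c : ℕ → ℂ) (a : ℕ → V → ℂ) : Prop where
  isAtom : ∀ j, T.IsAtom β (a j)
  summable_coeff : Summable (fun j => ‖c j‖)
  hasSum : ∀ x, HasSum (fun j => c j * a j x) (g x)

theorem isAtom_zero : T.IsAtom β 0 := by
  refine ⟨{T.ray 0}, Or.inl ⟨_, rfl⟩, fun _ _ => rfl, fun x => ?_, ?_⟩
  · simp [mass]
  · simp [integralOn]

variable {T β}

theorem IsAtomicDecomposition.add {g₁ g₂ : V → ℂ} {c₁ c₂ : ℕ → ℂ} {a₁ a₂ : ℕ → V → ℂ}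
    (h₁ : T.IsAtomicDecomposition β g₁ c₁ a₁) (h₂ : T.IsAtomicDecomposition β g₂ c₂ a₂) :
    ∃ c a, T.IsAtomicDecomposition β (g₁ + g₂) c a ∧
      ∑' j, ‖c j‖ = ∑' j, ‖c₁ j‖ + ∑' j, ‖c₂ j‖ := by
  obtain ⟨e⟩ : Nonempty (ℕ ≃ ℕ ⊕ ℕ) := ⟨Equiv.natSumNatEquivNat.symm⟩
  have hs : HasSum (fun s : ℕ ⊕ ℕ => ‖Sum.elim c₁ c₂ s‖) (∑' j, ‖c₁ j‖ + ∑' j, ‖c₂ j‖) :=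
    HasSum.sum h₁.summable_coeff.hasSum h₂.summable_coeff.hasSum
  have hs' := e.hasSum_iff.mpr hs
  refine ⟨fun j => Sum.elim c₁ c₂ (e j), fun j => Sum.elim a₁ a₂ (e j), ⟨fun j => ?_, ?_, ?_⟩, ?_⟩
  · rcases e j with i | i
    · exact h₁.isAtom i
    · exact h₂.isAtom i
  · exact hs'.summable
  · intro x
    have hx : HasSum (fun s : ℕ ⊕ ℕ => Sum.elim c₁ c₂ s * Sum.elim a₁ a₂ s x) (g₁ x + g₂ x) :=
      HasSum.sum (h₁.hasSum x) (h₂.hasSum x)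
    exact e.hasSum_iff.mpr hx
  · exact hs'.tsum_eq

theorem IsAtomicDecomposition.smul {g : V → ℂ} {c : ℕ → ℂ} {a : ℕ → V → ℂ} (z : ℂ)
    (h : T.IsAtomicDecomposition β g c a) :
    T.IsAtomicDecomposition β (z • g) (fun j => z * c j) a where
  isAtom := h.isAtom
  summable_coeff := by simpa using h.summable_coeff.mul_left ‖z‖
  hasSum := fun x => by simpa [mul_assoc] using (h.hasSum x).mul_left z

theorem isAtomicDecomposition_zero :
    T.IsAtomicDecomposition β 0 (fun _ => 0) (fun _ => 0) where
  isAtom := fun _ => isAtom_zero T β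
  summable_coeff := by simp
  hasSum := fun x => by simp

theorem IsAtom.norm_mul_le {a : V → ℂ} (h : T.IsAtom β a) (x : V) : ‖a x‖ * T.m x ≤ 1 := by
  obtain ⟨R, -, hsupp, hb, -⟩ := h
  by_cases hx : x ∈ R
  · by_cases htop : vertexMass T.m R = ∞
    · have := hb x
      simp only [mass, htop, ENNReal.toReal_top, inv_zero] at this
      have h0 : ‖a x‖ = 0 := le_antisymm this (norm_nonneg _)
      simp [h0]
    · have h1 : ENNReal.ofReal (T.m x) ≤ vertexMass T.m R :=
        ENNReal.le_tsum (f := fun y : R => ENNReal.ofReal (T.m y)) ⟨x, hx⟩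
      have h2 : T.m x ≤ T.mass R := by
        have := ENNReal.toReal_mono htop h1
        rwa [ENNReal.toReal_ofReal (T.m_pos x).le] at this
      have h3 : 0 < T.mass R := (T.m_pos x).trans_le h2
      calc ‖a x‖ * T.m x ≤ (T.mass R)⁻¹ * T.mass R :=
            mul_le_mul (hb x) h2 (T.m_pos x).le (inv_nonneg.mpr h3.le)
        _ = 1 := inv_mul_cancel₀ h3.ne'
  · simp [hsupp x hx]

theorem IsAtomicDecomposition.norm_mul_le {g : V → ℂ} {c : ℕ → ℂ} {a : ℕ → V → ℂ}
    (h : T.IsAtomicDecomposition β g c a) (x : V) : ‖g x‖ * T.m x ≤ ∑' j, ‖c j‖ := by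
  have hm := T.m_pos x
  rw [← le_div_iff₀ hm, ← (h.hasSum x).tsum_eq, div_eq_mul_inv, ← tsum_mul_right]
  refine tsum_of_norm_bounded (h.summable_coeff.mul_right _).hasSum fun j => ?_
  rw [norm_mul]
  refine mul_le_mul_of_nonneg_left ?_ (norm_nonneg _)
  rw [← one_div, le_div_iff₀ hm]
  exact (h.isAtom j).norm_mul_le x

variable (T β)

/-- The functions of the atomic Hardy space `H¹(m)`: the `g ∈ L¹(m)` that have an atomic
decomposition. -/
def hardySubmodule : Submodule ℂ (V → ℂ) where
  carrier := {g | Summable (fun x => T.m x * ‖g x‖) ∧ ∃ c a, T.IsAtomicDecomposition β g c a}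
  zero_mem' := ⟨by simp, _, _, isAtomicDecomposition_zero⟩
  add_mem' := by
    rintro g₁ g₂ ⟨s₁, c₁, a₁, h₁⟩ ⟨s₂, c₂, a₂, h₂⟩
    obtain ⟨c, a, h, -⟩ := h₁.add h₂
    refine ⟨Summable.of_nonneg_of_le (fun x => ?_) (fun x => ?_) (s₁.add s₂), c, a, h⟩
    · exact mul_nonneg (T.m_pos x).le (norm_nonneg _)
    · rw [← mul_add]
      exact mul_le_mul_of_nonneg_left (norm_add_le _ _) (T.m_pos x).le
  smul_mem' := by
    rintro z g ⟨s, c, a, h⟩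
    refine ⟨?_, _, _, h.smul z⟩
    simpa [mul_left_comm] using s.mul_left ‖z‖

/-- The atomic Hardy space `H¹(m)`; its topology is that of the atomic norm below (and not the
topology of pointwise convergence). -/
def Hardy : Type _ := T.hardySubmodule β

namespace Hardy

variable {T β}

/-- The function on the vertices that an element of `H¹(m)` is. -/
def toFun (g : Hardy T β) : V → ℂ := g.1

noncomputable instance : AddCommGroup (Hardy T β) :=
  inferInstanceAs (AddCommGroup (T.hardySubmodule β))

noncomputable instance : Module ℂ (Hardy T β) :=
  inferInstanceAs (Module ℂ (T.hardySubmodule β))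

/-- The values of `∑_j |c_j|` over all atomic decompositions of `g`. -/
def coeffSums (g : Hardy T β) : Set ℝ :=
  {s | ∃ c a, T.IsAtomicDecomposition β g.toFun c a ∧ s = ∑' j, ‖c j‖}

/-- The atomic norm, the infimum of `∑_j |c_j|` over all atomic decompositions of `g`. -/
noncomputable instance : Norm (Hardy T β) :=
  ⟨fun g => sInf g.coeffSums⟩

theorem norm_def (g : Hardy T β) : ‖g‖ = sInf g.coeffSums := rfl

theorem nonneg_of_mem_coeffSums {g : Hardy T β} {s : ℝ} (hs : s ∈ g.coeffSums) : 0 ≤ s := by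
  obtain ⟨c, a, -, rfl⟩ := hs
  exact tsum_nonneg fun _ => norm_nonneg _

theorem coeffSums_nonempty (g : Hardy T β) : g.coeffSums.Nonempty := by
  obtain ⟨-, c, a, h⟩ := g.2
  exact ⟨_, c, a, h, rfl⟩

theorem norm_le_of_mem {g : Hardy T β} {s : ℝ} (hs : s ∈ g.coeffSums) : ‖g‖ ≤ s :=
  csInf_le ⟨0, fun _ ht => nonneg_of_mem_coeffSums ht⟩ hs

theorem norm_smul_le' (z : ℂ) (g : Hardy T β) : ‖z • g‖ ≤ ‖z‖ * ‖g‖ := by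
  have key : ∀ s ∈ g.coeffSums, ‖z • g‖ ≤ ‖z‖ * s := by
    rintro s ⟨c, a, h, rfl⟩
    refine norm_le_of_mem ⟨_, a, h.smul z, ?_⟩
    simp only [norm_mul, tsum_mul_left]
  rcases eq_or_ne z 0 with rfl | hz
  · obtain ⟨s, hs⟩ := coeffSums_nonempty g
    simpa using key s hs
  · have hz' : 0 < ‖z‖ := norm_pos_iff.mpr hz
    rw [← div_le_iff₀' hz']
    refine le_csInf (coeffSums_nonempty g) fun s hs => ?_
    rw [div_le_iff₀' hz']
    exact key s hs

theorem normCore : NormedSpace.Core ℂ (Hardy T β) where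
  norm_nonneg g := Real.sInf_nonneg fun _ hs => nonneg_of_mem_coeffSums hs
  norm_smul z g := by
    refine le_antisymm (norm_smul_le' z g) ?_
    rcases eq_or_ne z 0 with rfl | hz
    · rw [norm_zero, zero_mul]
      exact Real.sInf_nonneg fun _ hs => nonneg_of_mem_coeffSums hs
    · have := norm_smul_le' z⁻¹ (z • g)
      rw [smul_smul, inv_mul_cancel₀ hz, one_smul, norm_inv] at this
      have hz' : 0 < ‖z‖ := norm_pos_iff.mpr hz
      rwa [← div_eq_inv_mul, le_div_iff₀' hz'] at this
  norm_triangle g₁ g₂ := by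
    refine le_of_forall_pos_le_add fun ε hε => ?_
    obtain ⟨s₁, ⟨c₁, a₁, h₁, rfl⟩, hs₁⟩ :=
      exists_lt_of_csInf_lt (coeffSums_nonempty g₁) (lt_add_of_pos_right ‖g₁‖ (half_pos hε))
    obtain ⟨s₂, ⟨c₂, a₂, h₂, rfl⟩, hs₂⟩ :=
      exists_lt_of_csInf_lt (coeffSums_nonempty g₂) (lt_add_of_pos_right ‖g₂‖ (half_pos hε))
    obtain ⟨c, a, h, hsum⟩ := h₁.add h₂
    have hle : ‖g₁ + g₂‖ ≤ ∑' j, ‖c j‖ := norm_le_of_mem ⟨c, a, h, rfl⟩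
    linarith
  norm_eq_zero_iff g := by
    constructor
    · intro h0
      refine Subtype.ext (funext fun x => ?_)
      have hle : ‖g.toFun x‖ * T.m x ≤ ‖g‖ := by
        refine le_csInf (coeffSums_nonempty g) ?_
        rintro s ⟨c, a, h, rfl⟩
        exact h.norm_mul_le x
      rw [h0] at hle
      have h1 : ‖g.toFun x‖ ≤ 0 := by
        by_contra hlt
        exact absurd hle (not_le.mpr (mul_pos (not_le.mp hlt) (T.m_pos x)))
      exact norm_le_zero_iff.mp h1
    · rintro rfl
      refine le_antisymm ?_ (Real.sInf_nonneg fun _ hs => nonneg_of_mem_coeffSums hs)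
      refine norm_le_of_mem ⟨_, _, isAtomicDecomposition_zero, ?_⟩
      simp

noncomputable instance : NormedAddCommGroup (Hardy T β) :=
  NormedAddCommGroup.ofCore normCore

noncomputable instance : NormedSpace ℂ (Hardy T β) :=
  NormedSpace.ofCore normCore

variable (T β)

/-- The subspace `H¹_fin(m)` of the finite linear combinations of atoms. -/
def finSubspace : Set (Hardy T β) :=
  {g | ∃ (N : ℕ) (c : ℕ → ℂ) (a : ℕ → V → ℂ), (∀ j < N, T.IsAtom β (a j)) ∧
    ∀ x, g.toFun x = ∑ j ∈ Finset.range N, c j * a j x}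

end Hardy

variable {β}

/-- The bounded functional `l` on `H¹(m)` is given by `g ↦ ∫_V f g dm` on `H¹_fin(m)`. -/
def Represents (f : V → ℂ) (l : Hardy T β →L[ℂ] ℂ) : Prop :=
  ∀ g ∈ Hardy.finSubspace T β, l g = T.integralOn Set.univ (fun x => f x * g.toFun x)

end FlowTree

/-! Local doubling bounds m(x)/m(y) uniformly over the sons y of x (`exists_m_le_mul_of_mem_sons`).
Hence every vertex has finitely many sons, every admissible trapezoid is finite, and all integrals
against atoms are finite sums. Density of finite combinations is then the convergence of the tails
of atomic series.

(i) Testing f on one atom gives at most the BMO norm, but this alone does not bound the functional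
on finite combinations: their norm is an infimum over infinite decompositions, through which an
unbounded f cannot simply be passed. For a given finite combination g, f is therefore replaced by a
truncation that equals f on the finite support of g. The truncation is bounded, so termwise
integration is legitimate, and it is 2-Lipschitz, so the atomic estimate loses only a factor 2,
independently of the truncation height (`MemBMO.norm_tsum_mul_le`).

(ii) Two adjacent vertices lie in a common admissible trapezoid, so telescoping along a walk puts
every difference of point masses into the span of atoms (`dirac_sub_dirac_mem`). Put f(x) = l(δ_x -
δ_o). Finite combinations of atoms are finitely supported with mean zero, hence are combinations of
the δ_x - δ_o, and f represents l. Testing l on a centred unimodular multiplier over R bounds the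
mean oscillation of f (`Represents.sum_norm_sub_average_le`). -/

/-! ### Geodesics in trees -/

/-- Both neighbours begin geodesics from `v` to `u`; these are paths, so they coincide in a tree. -/
theorem SimpleGraph.IsTree.eq_of_adj_of_dist_add_one {V : Type*} {G : SimpleGraph V}
    (hG : G.IsTree) {u v w₁ w₂ : V} (h₁ : G.Adj v w₁) (h₂ : G.Adj v w₂)
    (d₁ : G.dist u w₁ + 1 = G.dist u v) (d₂ : G.dist u w₂ + 1 = G.dist u v) : w₁ = w₂ := by
  obtain ⟨p₁, hp₁⟩ := hG.connected.exists_walk_length_eq_dist w₁ u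
  obtain ⟨p₂, hp₂⟩ := hG.connected.exists_walk_length_eq_dist w₂ u
  have q₁ : (SimpleGraph.Walk.cons h₁ p₁).IsPath := by
    apply SimpleGraph.Walk.isPath_of_length_eq_dist
    rw [SimpleGraph.Walk.length_cons, hp₁, G.dist_comm, d₁, G.dist_comm]
  have q₂ : (SimpleGraph.Walk.cons h₂ p₂).IsPath := by
    apply SimpleGraph.Walk.isPath_of_length_eq_dist
    rw [SimpleGraph.Walk.length_cons, hp₂, G.dist_comm, d₂, G.dist_comm]
  have h := (hG.existsUnique_path v u).unique q₁ q₂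
  simpa using congrArg SimpleGraph.Walk.snd h

theorem SimpleGraph.Connected.exists_adj_dist_add_one {V : Type*} {G : SimpleGraph V}
    (hG : G.Connected) {u v : V} (h : u ≠ v) : ∃ w, G.Adj v w ∧ G.dist u w + 1 = G.dist u v := by
  obtain ⟨p, hp⟩ := hG.exists_walk_length_eq_dist v u
  cases p with
  | nil => exact absurd rfl h
  | @cons _ w _ hw q =>
    refine ⟨w, hw, ?_⟩
    have h₁ : G.dist w u ≤ q.length := G.dist_le q
    have h₂ : G.dist v u ≤ G.dist v w + G.dist w u := hG.dist_triangle
    rw [SimpleGraph.dist_eq_one_iff_adj.mpr hw] at h₂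
    rw [SimpleGraph.Walk.length_cons] at hp
    rw [G.dist_comm (u := u) (v := w), G.dist_comm (u := u) (v := v)]
    omega

/-! ### Levels, parents and sons -/

namespace InfinityRootedTree

variable {V : Type*} (T : InfinityRootedTree V)

theorem dist_triangle (x y z : V) : T.graph.dist x z ≤ T.graph.dist x y + T.graph.dist y z :=
  T.isTree.connected.dist_triangle

theorem dist_ray_add (n k : ℕ) : T.graph.dist (T.ray n) (T.ray (n + k)) = k := by
  have h := T.ray_geodesic n (n + k)
  have h' : |(n : ℤ) - ((n + k : ℕ) : ℤ)| = k := by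
    rw [abs_sub_comm]
    push_cast
    rw [add_sub_cancel_left, abs_of_nonneg (Int.natCast_nonneg k)]
  rw [h'] at h
  exact_mod_cast h

theorem ray_adj (n : ℕ) : T.graph.Adj (T.ray n) (T.ray (n + 1)) :=
  SimpleGraph.dist_eq_one_iff_adj.mp (T.dist_ray_add n 1)

/-- Past the projection of `x`, the distance from the ray to `x` grows with unit speed. -/
theorem dist_ray_projIndex_add (x : V) (k : ℕ) :
    T.graph.dist x (T.ray (T.projIndex x + k)) =
      T.graph.dist x (T.ray (T.projIndex x)) + k := by
  have hmin : T.graph.dist x (T.ray (T.projIndex x)) ≤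
      T.graph.dist x (T.ray (T.projIndex x + 1)) := by
    have := Function.argmin_le (fun n : ℕ => T.graph.dist (T.ray n) x) (T.projIndex x + 1)
    rw [T.graph.dist_comm (u := x), T.graph.dist_comm (u := x)]
    exact this
  induction k with
  | zero => rfl
  | succ k ih =>
    have hstep := T.isTree.dist_eq_dist_add_one_of_adj x (T.ray_adj (T.projIndex x + k))
    rw [add_assoc] at hstep
    cases k with
    | zero =>
      simp only [zero_add, add_zero] at *
      omega
    | succ k =>
      rcases hstep with h | h
      -- If the distance dropped here, the current ray vertex would have two neighbours closer to
      -- `x`, its predecessor and its successor on the ray. They would coincide, but they are at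
      -- distance 2.
      · have hne := T.isTree.eq_of_adj_of_dist_add_one (u := x)
          (T.ray_adj (T.projIndex x + (k + 1))) (T.ray_adj (T.projIndex x + k)).symm
          (by rw [add_assoc]; exact h.symm) ?_
        · have h2 := T.dist_ray_add (T.projIndex x + k) 2
          rw [show T.projIndex x + k + 2 = T.projIndex x + (k + 1) + 1 by ring, hne] at h2
          simp at h2
        · have h3 : T.graph.dist x (T.ray (T.projIndex x + (k + 1))) ≤ _ := ih.le
          have h4 := T.isTree.dist_eq_dist_add_one_of_adj x (T.ray_adj (T.projIndex x + k))
          have h5 := T.dist_triangle x (T.ray (T.projIndex x + k)) (T.ray (T.projIndex x))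
          have h6 := T.dist_triangle x (T.ray (T.projIndex x)) (T.ray (T.projIndex x + k))
          rw [T.dist_ray_add] at h6
          rw [add_assoc] at h4
          omega
      · omega

theorem level_eq (x : V) (k : ℕ) :
    T.level x = ((T.projIndex x + k : ℕ) : ℤ) -
      T.graph.dist x (T.ray (T.projIndex x + k)) := by
  rw [level, dist_ray_projIndex_add, T.graph.dist_comm (u := T.ray (T.projIndex x))]
  have := T.dist_ray_add 0 (T.projIndex x)
  rw [zero_add] at this
  rw [this]
  push_cast
  ring

/-- The level is the Busemann function of the ray. Levels of several vertices can thus be compared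
through one common far ray vertex. -/
theorem level_eq_of_le {x : V} {n : ℕ} (h : T.projIndex x ≤ n) :
    T.level x = (n : ℤ) - T.graph.dist x (T.ray n) := by
  obtain ⟨k, rfl⟩ := Nat.exists_eq_add_of_le h
  exact T.level_eq x k

theorem sub_dist_le_level (x : V) (n : ℕ) :
    (n : ℤ) - T.graph.dist x (T.ray n) ≤ T.level x := by
  rw [T.level_eq_of_le (n := n + T.projIndex x) (Nat.le_add_left _ _)]
  have := T.dist_triangle x (T.ray n) (T.ray (n + T.projIndex x))
  rw [T.dist_ray_add] at this
  push_cast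
  omega

theorem level_sub_le (x y : V) : T.level x - T.level y ≤ T.graph.dist x y := by
  have h₁ := T.level_eq_of_le (le_refl (T.projIndex x))
  have h₂ := T.sub_dist_le_level y (T.projIndex x)
  have h₃ := T.dist_triangle y x (T.ray (T.projIndex x))
  rw [T.graph.dist_comm (u := y) (v := x)] at h₃
  omega

theorem level_eq_or_of_adj {x y : V} (h : T.graph.Adj x y) :
    T.level y = T.level x + 1 ∨ T.level y = T.level x - 1 := by
  have h₁ := T.level_eq_of_le (le_max_left (T.projIndex x) (T.projIndex y))
  have h₂ := T.level_eq_of_le (le_max_right (T.projIndex x) (T.projIndex y))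
  have h₃ := T.isTree.dist_eq_dist_add_one_of_adj (T.ray (max (T.projIndex x) (T.projIndex y))) h
  rw [T.graph.dist_comm, T.graph.dist_comm (v := y)] at h₃
  omega

theorem exists_parent (x : V) : ∃ y, T.graph.Adj x y ∧ T.level y = T.level x + 1 := by
  -- One step past the projection, so that the target differs from `x` even when `x` lies on the
  -- ray.
  have hx := T.level_eq x 1
  have hne : T.ray (T.projIndex x + 1) ≠ x := by
    intro h
    have := T.dist_ray_projIndex_add x 1
    rw [h] at this
    simp at this
  obtain ⟨y, hy, hd⟩ := T.isTree.connected.exists_adj_dist_add_one hne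
  refine ⟨y, hy, ?_⟩
  have := T.sub_dist_le_level y (T.projIndex x + 1)
  rw [T.graph.dist_comm, T.graph.dist_comm (v := x)] at hd
  rcases T.level_eq_or_of_adj hy with h | h <;> omega

theorem parent_unique {x y z : V} (hy : T.graph.Adj x y) (hz : T.graph.Adj x z)
    (ly : T.level y = T.level x + 1) (lz : T.level z = T.level x + 1) : y = z := by
  set n := max (T.projIndex x) (max (T.projIndex y) (T.projIndex z))
  have h₁ := T.level_eq_of_le (x := x) (n := n) (by omega)
  have h₂ := T.level_eq_of_le (x := y) (n := n) (by omega)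
  have h₃ := T.level_eq_of_le (x := z) (n := n) (by omega)
  rw [T.graph.dist_comm] at h₁ h₂ h₃
  exact T.isTree.eq_of_adj_of_dist_add_one (u := T.ray n) hy hz (by omega) (by omega)

/-- A ball of radius one consists of its centre, the parent, and the sons. -/
theorem ball_one_subset {x y : V} (hy : T.graph.Adj x y) (ly : T.level y = T.level x + 1) :
    T.ball x 1 ⊆ ({x} ∪ {y}) ∪ T.sons x := by
  intro z hz
  have hz : T.graph.dist z x ≤ 1 := hz
  rcases Nat.le_one_iff_eq_zero_or_eq_one.mp hz with h | h
  · exact Or.inl (Or.inl (T.isTree.connected.dist_eq_zero_iff.mp h))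
  · have hadj := (SimpleGraph.dist_eq_one_iff_adj.mp h).symm
    rcases T.level_eq_or_of_adj hadj with l | l
    · exact Or.inl (Or.inr (T.parent_unique hadj hy l ly))
    · exact Or.inr ⟨hadj, l⟩

/-- The geodesic from `x` to a vertex below it loses one level at each step, since the level is
1-Lipschitz; so its first step goes to a son. -/
theorem finite_below_dist (hfin : ∀ x, (T.sons x).Finite) (n : ℕ) (x : V) :
    {y | T.Below y x ∧ T.graph.dist y x = n}.Finite := by
  induction n generalizing x with
  | zero =>
    refine (Set.finite_singleton x).subset fun y hy => ?_
    exact T.isTree.connected.dist_eq_zero_iff.mp hy.2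
  | succ n ih =>
    refine ((hfin x).biUnion fun z _ => ih z).subset ?_
    rintro y ⟨hb, hd⟩
    have hb' : T.level x - T.level y = T.graph.dist y x := hb
    have hne : y ≠ x := by
      rintro rfl
      simp at hd
    obtain ⟨z, hz, hzd⟩ := T.isTree.connected.exists_adj_dist_add_one hne
    have h₁ := T.level_sub_le z y
    rw [T.graph.dist_comm] at h₁
    have h₂ := T.level_eq_or_of_adj hz
    simp only [Set.mem_iUnion]
    refine ⟨z, ⟨hz, by omega⟩, ?_, by omega⟩
    change T.level z - T.level y = T.graph.dist y z
    omega

theorem finite_trapezoid (hfin : ∀ x, (T.sons x).Finite) (x : V) (h' h'' : ℕ) :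
    (T.trapezoid x h' h'').Finite := by
  refine ((Set.finite_Iio h'').biUnion fun n _ => T.finite_below_dist hfin n x).subset ?_
  rintro y ⟨hb, hl, -⟩
  have hb' : T.level x - T.level y = T.graph.dist y x := hb
  simp only [Set.mem_iUnion]
  exact ⟨T.graph.dist y x, by simp only [Set.mem_Iio]; omega, hb, rfl⟩

end InfinityRootedTree

/-! ### Local doubling and finiteness of trapezoids -/

namespace FlowTree

variable {V : Type*} (T : FlowTree V)

theorem sons_nonempty (x : V) : (T.sons x).Nonempty := by
  rw [Set.nonempty_iff_ne_empty]
  intro h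
  have hs := T.flow x
  rw [h] at hs
  exact (T.m_pos x).ne (hasSum_empty.unique hs)

theorem vertexMass_sons (x : V) : vertexMass T.m (T.sons x) = ENNReal.ofReal (T.m x) := by
  rw [vertexMass, ← ENNReal.ofReal_tsum_of_nonneg (f := fun y : T.sons x => T.m y)
    (fun y => (T.m_pos y).le) (T.flow x).summable, (T.flow x).tsum_eq]

theorem m_le_of_mem_sons {x y : V} (h : y ∈ T.sons x) : T.m y ≤ T.m x :=
  le_hasSum (T.flow x) ⟨y, h⟩ fun z _ => (T.m_pos z).le

/-- Take a son `z` of `y`. The ball of radius 2 about `z` contains `x`, while the ball of radius 1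
has mass at most 2m(z) + m(y) ≤ 3m(y), by the flow condition at `z`. Doubling at radius 1 compares
the two. -/
theorem exists_m_le_mul_of_mem_sons :
    ∃ K : ℝ, 0 < K ∧ ∀ x, ∀ y ∈ T.sons x, T.m x ≤ K * T.m y := by
  obtain ⟨C, hC, hdoub⟩ := T.locally_doubling 1 one_pos
  refine ⟨C * 3, by positivity, fun x y hy => ?_⟩
  obtain ⟨z, hz⟩ := T.sons_nonempty y
  have hlow : ENNReal.ofReal (T.m x) ≤ vertexMass T.m (T.ball z (2 * 1)) := by
    have hx : x ∈ T.ball z (2 * 1) := by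
      have := T.dist_triangle x y z
      rw [SimpleGraph.dist_eq_one_iff_adj.mpr hy.1, SimpleGraph.dist_eq_one_iff_adj.mpr hz.1] at this
      exact this
    exact ENNReal.le_tsum (f := fun w : T.ball z (2 * 1) => ENNReal.ofReal (T.m w)) ⟨x, hx⟩
  have hup : vertexMass T.m (T.ball z 1) ≤
      ENNReal.ofReal (T.m z) + ENNReal.ofReal (T.m y) + ENNReal.ofReal (T.m z) := by
    have hz' : T.level y = T.level z + 1 := by rw [hz.2]; ring
    calc vertexMass T.m (T.ball z 1)
        ≤ vertexMass T.m (({z} ∪ {y}) ∪ T.sons z) :=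
          ENNReal.tsum_mono_subtype (fun w => ENNReal.ofReal (T.m w))
            (T.ball_one_subset hz.1.symm hz')
      _ ≤ vertexMass T.m ({z} ∪ {y}) + vertexMass T.m (T.sons z) :=
          ENNReal.tsum_union_le (fun w => ENNReal.ofReal (T.m w)) _ _
      _ ≤ vertexMass T.m {z} + vertexMass T.m {y} + vertexMass T.m (T.sons z) :=
          add_le_add_left (ENNReal.tsum_union_le (fun w => ENNReal.ofReal (T.m w)) _ _) _
      _ = _ := by
          rw [vertexMass_sons]
          simp [vertexMass]
  have h := hlow.trans ((hdoub z).trans (mul_le_mul_right hup _))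
  have hzy := T.m_le_of_mem_sons hz
  have pz := (T.m_pos z).le
  have py := (T.m_pos y).le
  rw [← ENNReal.ofReal_add pz py, ← ENNReal.ofReal_add (by positivity) pz,
    ← ENNReal.ofReal_mul (by positivity), ENNReal.ofReal_le_ofReal_iff (by positivity)] at h
  refine h.trans ?_
  rw [mul_assoc]
  exact mul_le_mul_of_nonneg_left (by linarith) (by positivity)

/-- The masses of the sons sum to m(x) and are bounded below by a fixed multiple of m(x). -/
theorem finite_sons (x : V) : (T.sons x).Finite := by
  obtain ⟨K, hK, h⟩ := T.exists_m_le_mul_of_mem_sons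
  have hs : Summable (fun _ : T.sons x => T.m x / K) := by
    refine Summable.of_nonneg_of_le (fun _ => div_nonneg (T.m_pos x).le hK.le) (fun y => ?_)
      (T.flow x).summable
    rw [div_le_iff₀' hK]
    exact h x y y.2
  by_contra hinf
  have : Infinite (T.sons x) := Set.infinite_coe_iff.mpr hinf
  exact (div_pos (T.m_pos x) hK).ne' ((summable_const_iff _).mp hs)

theorem finite_of_isAdmissible {β : ℝ} {R : Set V} (h : T.IsAdmissible β R) : R.Finite := by
  rcases h with ⟨x, rfl⟩ | ⟨x, h', h'', -, -, -, -, rfl⟩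
  · exact Set.finite_singleton x
  · exact T.finite_trapezoid T.finite_sons x h' h''

end FlowTree

/-! ### Atoms, finite combinations and their density -/

namespace FlowTree

variable {V : Type*} (T : FlowTree V) (β : ℝ)

theorem integralOn_coe {E : Type*} [NormedAddCommGroup E] [NormedSpace ℝ E] (s : Finset V)
    (f : V → E) : T.integralOn (s : Set V) f = ∑ x ∈ s, T.m x • f x :=
  Finset.tsum_subtype s fun x => T.m x • f x

theorem integralOn_univ_eq_sum {E : Type*} [NormedAddCommGroup E] [NormedSpace ℝ E] {s : Finset V}
    {f : V → E} (h : ∀ x ∉ s, f x = 0) : T.integralOn Set.univ f = ∑ x ∈ s, T.m x • f x := by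
  rw [integralOn, tsum_univ fun x => T.m x • f x]
  exact tsum_eq_sum fun x hx => by rw [h x hx, smul_zero]

theorem mass_coe (s : Finset V) : T.mass (s : Set V) = ∑ x ∈ s, T.m x := by
  have h : vertexMass T.m (s : Set V) = ∑ x ∈ s, ENNReal.ofReal (T.m x) :=
    Finset.tsum_subtype s fun x => ENNReal.ofReal (T.m x)
  rw [mass, h, ← ENNReal.ofReal_sum_of_nonneg fun x _ => (T.m_pos x).le,
    ENNReal.toReal_ofReal (Finset.sum_nonneg fun x _ => (T.m_pos x).le)]

theorem mass_pos {T : FlowTree V} {s : Finset V} (hs : s.Nonempty) : 0 < T.mass (s : Set V) := by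
  rw [mass_coe]
  exact Finset.sum_pos (fun x _ => T.m_pos x) hs

theorem mass_nonneg (R : Set V) : 0 ≤ T.mass R := ENNReal.toReal_nonneg

theorem mass_mul_average (s : Finset V) (f : V → ℂ) :
    (T.mass (s : Set V) : ℂ) * T.average s f = ∑ x ∈ s, T.m x * f x := by
  rcases s.eq_empty_or_nonempty with rfl | hs
  · rw [mass_coe]
    simp
  · have h : T.mass (s : Set V) ≠ 0 := (mass_pos hs).ne'
    rw [average, integralOn_coe, Complex.real_smul, Complex.ofReal_inv,
      mul_inv_cancel_left₀ (by exact_mod_cast h)]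
    simp only [Complex.real_smul]

variable {T β}

theorem IsAtom.exists_finset {a : V → ℂ} (h : T.IsAtom β a) :
    ∃ s : Finset V, T.IsAdmissible β (s : Set V) ∧ (∀ x ∉ s, a x = 0) ∧
      (∀ x, ‖a x‖ ≤ (T.mass (s : Set V))⁻¹) ∧ ∑ x ∈ s, T.m x * a x = 0 := by
  obtain ⟨R, hR, h₁, h₂, h₃⟩ := h
  lift R to Finset V using T.finite_of_isAdmissible hR
  rw [integralOn_coe] at h₃
  simp only [Complex.real_smul] at h₃
  exact ⟨R, hR, fun x hx => h₁ x (by simpa using hx), h₂, h₃⟩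

theorem IsAtom.of_finset {a : V → ℂ} {s : Finset V} (hs : T.IsAdmissible β (s : Set V))
    (h₁ : ∀ x ∉ s, a x = 0) (h₂ : ∀ x, ‖a x‖ ≤ (T.mass (s : Set V))⁻¹)
    (h₃ : ∑ x ∈ s, T.m x * a x = 0) : T.IsAtom β a := by
  refine ⟨s, hs, fun x hx => h₁ x (by simpa using hx), h₂, ?_⟩
  rw [integralOn_coe]
  simpa only [Complex.real_smul] using h₃

/-- Atoms are bounded by one in `L¹(m)`. -/
theorem IsAtom.exists_sum_le {a : V → ℂ} (h : T.IsAtom β a) :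
    ∃ s : Finset V, (∀ x ∉ s, a x = 0) ∧ ∑ x ∈ s, T.m x * ‖a x‖ ≤ 1 := by
  obtain ⟨s, -, h₁, h₂, -⟩ := h.exists_finset
  refine ⟨s, h₁, ?_⟩
  calc ∑ x ∈ s, T.m x * ‖a x‖ ≤ ∑ x ∈ s, T.m x * (T.mass (s : Set V))⁻¹ :=
        Finset.sum_le_sum fun x _ => mul_le_mul_of_nonneg_left (h₂ x) (T.m_pos x).le
    _ = T.mass (s : Set V) * (T.mass (s : Set V))⁻¹ := by rw [← Finset.sum_mul, ← mass_coe]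
    _ ≤ 1 := mul_inv_le_one

theorem IsAtom.isAtomicDecomposition {a : V → ℂ} (h : T.IsAtom β a) :
    T.IsAtomicDecomposition β a (fun j => if j = 0 then 1 else 0) fun _ => a where
  isAtom _ := h
  summable_coeff := summable_of_ne_finset_zero (s := {0}) fun j hj => by
    rw [if_neg (by simpa using hj), norm_zero]
  hasSum x := by
    convert hasSum_ite_eq (0 : ℕ) (a x) using 2 with j
    split_ifs <;> simp

namespace Hardy

variable (T β) in
/-- The linear map that sends an element of `H¹(m)` to the underlying function. -/
noncomputable def toFunLinear : Hardy T β →ₗ[ℂ] V → ℂ := (T.hardySubmodule β).subtype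

theorem toFunLinear_apply (g : Hardy T β) : toFunLinear T β g = g.toFun := rfl

theorem ext {g h : Hardy T β} (H : ∀ x, g.toFun x = h.toFun x) : g = h :=
  Subtype.ext (funext H)

theorem add_toFun (g h : Hardy T β) (x : V) : (g + h).toFun x = g.toFun x + h.toFun x := rfl

theorem sub_toFun (g h : Hardy T β) (x : V) : (g - h).toFun x = g.toFun x - h.toFun x := rfl

theorem smul_toFun (z : ℂ) (g : Hardy T β) (x : V) : (z • g).toFun x = z * g.toFun x := rfl

theorem sum_toFun {ι : Type*} (s : Finset ι) (g : ι → Hardy T β) (x : V) :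
    (∑ i ∈ s, g i).toFun x = ∑ i ∈ s, (g i).toFun x := by
  rw [← toFunLinear_apply, map_sum, Finset.sum_apply]
  rfl

/-- An atom as an element of `H¹(m)`. -/
noncomputable def ofAtom {a : V → ℂ} (h : T.IsAtom β a) : Hardy T β := by
  refine ⟨a, ?_, _, _, h.isAtomicDecomposition⟩
  obtain ⟨s, hs, -⟩ := h.exists_sum_le
  exact summable_of_ne_finset_zero (s := s) fun x hx => by rw [hs x hx, norm_zero, mul_zero]

theorem ofAtom_toFun {a : V → ℂ} (h : T.IsAtom β a) (x : V) : (ofAtom h).toFun x = a x := rfl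

theorem norm_ofAtom_le {a : V → ℂ} (h : T.IsAtom β a) : ‖ofAtom h‖ ≤ 1 := by
  refine norm_le_of_mem ⟨_, _, h.isAtomicDecomposition, ?_⟩
  rw [tsum_eq_single 0 fun j hj => by rw [if_neg hj, norm_zero]]
  simp

variable (T β) in
/-- `H¹_fin(m)` as a linear subspace. -/
noncomputable def finSubmodule : Submodule ℂ (Hardy T β) :=
  Submodule.span ℂ {g | T.IsAtom β g.toFun}

theorem sum_mem_finSubspace {N : ℕ} {c : ℕ → ℂ} {a : ℕ → V → ℂ} (ha : ∀ j, T.IsAtom β (a j)) :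
    ∑ j ∈ Finset.range N, c j • ofAtom (ha j) ∈ finSubspace T β := by
  refine ⟨N, c, a, fun j _ => ha j, fun x => ?_⟩
  simp only [sum_toFun, smul_toFun, ofAtom_toFun]

theorem exists_of_mem_finSubspace {g : Hardy T β} (hg : g ∈ finSubspace T β) :
    ∃ (N : ℕ) (c : ℕ → ℂ) (a : ℕ → V → ℂ) (ha : ∀ j, T.IsAtom β (a j)),
      g = ∑ j ∈ Finset.range N, c j • ofAtom (ha j) := by
  obtain ⟨N, c, a, ha, hg⟩ := hg
  -- Padding with the zero atom makes every index carry an atom.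
  refine ⟨N, c, fun j => if j < N then a j else 0, fun j => ?_, ?_⟩
  · beta_reduce
    split_ifs with hj
    · exact ha j hj
    · exact isAtom_zero T β
  · refine ext fun x => ?_
    rw [hg, sum_toFun]
    refine Finset.sum_congr rfl fun j hj => ?_
    rw [smul_toFun, ofAtom_toFun]
    simp only [if_pos (Finset.mem_range.mp hj)]

theorem coe_finSubmodule : (finSubmodule T β : Set (Hardy T β)) = finSubspace T β := by
  ext g
  constructor
  · intro hg
    refine Submodule.span_induction (p := fun g _ => g ∈ finSubspace T β) ?_ ?_ ?_ ?_ hg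
    · intro g hg
      exact ⟨1, fun _ => 1, fun _ => g.toFun, fun _ _ => hg, fun x => by simp⟩
    · exact ⟨0, fun _ => 0, fun _ => 0, fun _ h => absurd h (Nat.not_lt_zero _), fun x => rfl⟩
    · rintro g₁ g₂ - - ⟨N₁, c₁, a₁, ha₁, h₁⟩ ⟨N₂, c₂, a₂, ha₂, h₂⟩
      refine ⟨N₁ + N₂, fun j => if j < N₁ then c₁ j else c₂ (j - N₁),
        fun j => if j < N₁ then a₁ j else a₂ (j - N₁), fun j hj => ?_, fun x => ?_⟩
      · beta_reduce
        split_ifs with h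
        · exact ha₁ j h
        · exact ha₂ _ (by omega)
      · rw [add_toFun, h₁, h₂, Finset.sum_range_add]
        congr 1
        · refine Finset.sum_congr rfl fun j hj => ?_
          simp only [if_pos (Finset.mem_range.mp hj)]
        · refine Finset.sum_congr rfl fun j _ => ?_
          simp
    · rintro z g - ⟨N, c, a, ha, h⟩
      refine ⟨N, fun j => z * c j, a, ha, fun x => ?_⟩
      rw [smul_toFun, h, Finset.mul_sum]
      simp only [mul_assoc]
  · intro hg
    obtain ⟨N, c, a, ha, rfl⟩ := exists_of_mem_finSubspace hg
    exact Submodule.sum_mem _ fun j _ => Submodule.smul_mem _ _ (Submodule.subset_span (ha j))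

theorem dense_finSubspace : Dense (finSubspace T β) := by
  intro g
  rw [Metric.mem_closure_iff]
  intro ε hε
  obtain ⟨c, a, h⟩ := g.2.2
  have htail := tendsto_sum_nat_add fun j => ‖c j‖
  obtain ⟨N, hN⟩ := (htail.eventually (gt_mem_nhds hε)).exists
  refine ⟨_, sum_mem_finSubspace (N := N) (c := c) h.isAtom, ?_⟩
  rw [dist_eq_norm]
  -- The tail of the series is itself an atomic decomposition of the error.
  refine lt_of_le_of_lt (norm_le_of_mem ⟨fun j => c (j + N), fun j => a (j + N), ⟨fun j => h.isAtom _,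
    (summable_nat_add_iff N).mpr h.summable_coeff, fun x => ?_⟩, rfl⟩) hN
  rw [sub_toFun, sum_toFun]
  simp only [smul_toFun, ofAtom_toFun]
  exact (hasSum_nat_add_iff' N).mpr (h.hasSum x)

/-- Elements of `H¹_fin(m)` have finite support and vanishing integral. -/
theorem exists_finset_of_mem_finSubspace {g : Hardy T β} (hg : g ∈ finSubspace T β) :
    ∃ s : Finset V, (∀ x ∉ s, g.toFun x = 0) ∧ ∑ x ∈ s, T.m x * g.toFun x = 0 := by
  classical
  obtain ⟨N, c, a, ha, rfl⟩ := exists_of_mem_finSubspace hg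
  choose s _ hs _ hint using fun j => (ha j).exists_finset
  refine ⟨(Finset.range N).biUnion s, fun x hx => ?_, ?_⟩
  · rw [sum_toFun]
    refine Finset.sum_eq_zero fun j hj => ?_
    rw [smul_toFun, ofAtom_toFun, hs j x fun h => hx (Finset.mem_biUnion.mpr ⟨j, hj, h⟩), mul_zero]
  · simp only [sum_toFun, smul_toFun, ofAtom_toFun, Finset.mul_sum]
    rw [Finset.sum_comm]
    refine Finset.sum_eq_zero fun j hj => ?_
    rw [← Finset.sum_subset (Finset.subset_biUnion_of_mem s hj)
      fun x _ hx => by rw [hs j x hx, mul_zero, mul_zero]]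
    simp only [mul_left_comm _ (c j)]
    rw [← Finset.mul_sum, hint, mul_zero]

end Hardy

end FlowTree

/-! ### Functionals defined by BMO functions -/

/-- The truncation of the real and imaginary parts of `z` to `[-M, M]`. -/
noncomputable def Complex.clamp (M : ℝ) (z : ℂ) : ℂ :=
  ⟨max (-M) (min M z.re), max (-M) (min M z.im)⟩

theorem abs_clamp_sub_clamp_le (M s t : ℝ) :
    |max (-M) (min M s) - max (-M) (min M t)| ≤ |s - t| :=
  (abs_max_sub_max_le_max _ _ _ _).trans <| max_le (by simp) <|
    (abs_min_sub_min_le_max _ _ _ _).trans <| max_le (by simp) le_rfl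

/-- Each of the two coordinates contributes at most ‖z - w‖; this is the source of the constant 2 in
(i). -/
theorem Complex.norm_clamp_sub_clamp_le (M : ℝ) (z w : ℂ) :
    ‖clamp M z - clamp M w‖ ≤ 2 * ‖z - w‖ := by
  have h₁ := (abs_clamp_sub_clamp_le M z.re w.re).trans (Complex.abs_re_le_norm (z - w))
  have h₂ := (abs_clamp_sub_clamp_le M z.im w.im).trans (Complex.abs_im_le_norm (z - w))
  refine (Complex.norm_le_abs_re_add_abs_im _).trans ?_
  rw [two_mul]
  exact add_le_add h₁ h₂

theorem Complex.clamp_eq_self {M : ℝ} {z : ℂ} (h : ‖z‖ ≤ M) : clamp M z = z := by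
  have h₁ := abs_le.mp ((Complex.abs_re_le_norm z).trans h)
  have h₂ := abs_le.mp ((Complex.abs_im_le_norm z).trans h)
  apply Complex.ext
  · change max (-M) (min M z.re) = z.re
    rw [min_eq_right h₁.2, max_eq_right h₁.1]
  · change max (-M) (min M z.im) = z.im
    rw [min_eq_right h₂.2, max_eq_right h₂.1]

theorem Complex.norm_clamp_le {M : ℝ} (hM : 0 ≤ M) (z : ℂ) : ‖clamp M z‖ ≤ 2 * M := by
  have key : ∀ t : ℝ, |max (-M) (min M t)| ≤ M := fun t =>
    abs_le.mpr ⟨le_max_left _ _, max_le (by linarith) (min_le_left _ _)⟩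
  refine (Complex.norm_le_abs_re_add_abs_im _).trans ?_
  rw [two_mul]
  exact add_le_add (key _) (key _)

theorem Complex.exists_norm_le_one_mul_eq_norm (z : ℂ) : ∃ u : ℂ, ‖u‖ ≤ 1 ∧ z * u = ‖z‖ := by
  -- At z = 0 the quotient is 0, so its norm is only bounded by 1.
  refine ⟨(starRingEnd ℂ) z / ‖z‖, ?_, ?_⟩
  · rw [norm_div, RCLike.norm_conj, Complex.norm_real, norm_norm]
    exact div_self_le_one _
  · rcases eq_or_ne z 0 with rfl | hz
    · simp
    · rw [← mul_div_assoc, Complex.mul_conj', sq, mul_div_assoc, div_self (by simpa using hz),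
        mul_one]

namespace FlowTree

variable {V : Type*} {T : FlowTree V} {β : ℝ}

theorem MemBMO.sum_norm_sub_average_le {f : V → ℂ} (hf : T.MemBMO β f) {s : Finset V}
    (hs : T.IsAdmissible β (s : Set V)) :
    ∑ x ∈ s, T.m x * ‖f x - T.average s f‖ ≤
      T.mass (s : Set V) * (T.bmoNorm β f).toReal := by
  rcases s.eq_empty_or_nonempty with rfl | hne
  · rw [mass_coe]
    simp
  · have hpos : 0 < T.mass (s : Set V) := mass_pos hne
    have h : ENNReal.ofReal ((T.mass (s : Set V))⁻¹ *
        T.integralOn (s : Set V) (fun x => ‖f x - T.average s f‖)) ≤ T.bmoNorm β f :=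
      le_iSup₂_of_le (f := fun (R : Set V) (_ : T.IsAdmissible β R) =>
        ENNReal.ofReal ((T.mass R)⁻¹ * T.integralOn R (fun x => ‖f x - T.average R f‖)))
        (s : Set V) hs le_rfl
    rw [ENNReal.ofReal_le_iff_le_toReal (ne_of_lt hf), inv_mul_le_iff₀ hpos, integralOn_coe] at h
    simpa only [smul_eq_mul] using h

/-- The general Lipschitz `F` allows truncations of `f`. As the atom has mean zero, the constant
F(f_R) can be subtracted from F ∘ f, which leaves the oscillation of `f` itself. -/
theorem IsAtom.norm_tsum_comp_mul_le {a f : V → ℂ} (ha : T.IsAtom β a) (hf : T.MemBMO β f)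
    {F : ℂ → ℂ} {K : ℝ} (hK : 0 ≤ K) (hF : ∀ z w, ‖F z - F w‖ ≤ K * ‖z - w‖) :
    ‖∑' x, T.m x * (F (f x) * a x)‖ ≤ K * (T.bmoNorm β f).toReal := by
  obtain ⟨s, hs, hsupp, hb, hint⟩ := ha.exists_finset
  rw [tsum_eq_sum (s := s) fun x hx => by rw [hsupp x hx, mul_zero, mul_zero]]
  have hsub : ∑ x ∈ s, T.m x * (F (f x) * a x) =
      ∑ x ∈ s, T.m x * ((F (f x) - F (T.average s f)) * a x) := by
    have : ∑ x ∈ s, F (T.average s f) * (T.m x * a x) = 0 := by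
      rw [← Finset.mul_sum, hint, mul_zero]
    rw [← sub_zero (∑ x ∈ s, T.m x * (F (f x) * a x)), ← this, ← Finset.sum_sub_distrib]
    exact Finset.sum_congr rfl fun x _ => by ring
  have hB : 0 ≤ (T.bmoNorm β f).toReal := ENNReal.toReal_nonneg
  have hm := inv_nonneg.mpr (T.mass_nonneg s)
  rw [hsub]
  calc ‖∑ x ∈ s, T.m x * ((F (f x) - F (T.average s f)) * a x)‖
      ≤ ∑ x ∈ s, (T.mass (s : Set V))⁻¹ * K * (T.m x * ‖f x - T.average s f‖) := by
        refine norm_sum_le_of_le s fun x _ => ?_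
        rw [norm_mul, norm_mul, Complex.norm_of_nonneg (T.m_pos x).le]
        calc T.m x * (‖F (f x) - F (T.average s f)‖ * ‖a x‖)
            ≤ T.m x * (K * ‖f x - T.average s f‖ * (T.mass (s : Set V))⁻¹) := by
              have := (T.m_pos x).le
              gcongr
              · exact hF _ _
              · exact hb x
          _ = _ := by ring
    _ = (T.mass (s : Set V))⁻¹ * K * ∑ x ∈ s, T.m x * ‖f x - T.average s f‖ := by
        rw [Finset.mul_sum]
    _ ≤ (T.mass (s : Set V))⁻¹ * K * (T.mass (s : Set V) * (T.bmoNorm β f).toReal) :=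
        mul_le_mul_of_nonneg_left (hf.sum_norm_sub_average_le hs) (mul_nonneg hm hK)
    _ = T.mass (s : Set V) * (T.mass (s : Set V))⁻¹ * (K * (T.bmoNorm β f).toReal) := by ring
    _ ≤ 1 * (K * (T.bmoNorm β f).toReal) :=
        mul_le_mul_of_nonneg_right mul_inv_le_one (mul_nonneg hK hB)
    _ = _ := one_mul _

/-- A bounded function may be integrated termwise against an atomic decomposition. -/
theorem IsAtomicDecomposition.tsum_bounded_mul {g u : V → ℂ} {c : ℕ → ℂ} {a : ℕ → V → ℂ}
    (h : T.IsAtomicDecomposition β g c a) {M : ℝ} (hu : ∀ x, ‖u x‖ ≤ M) :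
    ∑' x, T.m x * (u x * g x) = ∑' j, c j * ∑' x, T.m x * (u x * a j x) := by
  have hM : 0 ≤ M := (norm_nonneg _).trans (hu (T.ray 0))
  -- The rows are at most M|c_j|, because atoms have L¹ norm at most 1; this permits exchanging the
  -- sums.
  have hsum : Summable (Function.uncurry fun j x => c j * (T.m x * (u x * a j x))) := by
    apply Summable.of_norm
    have hrow : ∀ j, ∃ s : Finset V, (∀ x ∉ s, ‖c j * (T.m x * (u x * a j x))‖ = 0) ∧
        ∑ x ∈ s, ‖c j * (T.m x * (u x * a j x))‖ ≤ ‖c j‖ * M := by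
      intro j
      obtain ⟨s, hs, hs'⟩ := (h.isAtom j).exists_sum_le
      refine ⟨s, fun x hx => by rw [hs x hx]; simp, ?_⟩
      calc ∑ x ∈ s, ‖c j * (T.m x * (u x * a j x))‖
          ≤ ∑ x ∈ s, ‖c j‖ * M * (T.m x * ‖a j x‖) := by
            refine Finset.sum_le_sum fun x _ => ?_
            rw [norm_mul, norm_mul, norm_mul, Complex.norm_of_nonneg (T.m_pos x).le]
            calc ‖c j‖ * (T.m x * (‖u x‖ * ‖a j x‖)) ≤ ‖c j‖ * (T.m x * (M * ‖a j x‖)) := by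
                  have := (T.m_pos x).le
                  gcongr
                  exact hu x
              _ = _ := by ring
        _ = ‖c j‖ * M * ∑ x ∈ s, T.m x * ‖a j x‖ := by rw [Finset.mul_sum]
        _ ≤ ‖c j‖ * M * 1 := mul_le_mul_of_nonneg_left hs' (mul_nonneg (norm_nonneg _) hM)
        _ = _ := mul_one _
    refine (summable_prod_of_nonneg fun _ => norm_nonneg _).mpr ⟨fun j => ?_, ?_⟩
    · obtain ⟨s, hs, -⟩ := hrow j
      exact summable_of_ne_finset_zero hs
    · refine Summable.of_nonneg_of_le (fun j => tsum_nonneg fun _ => norm_nonneg _) (fun j => ?_)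
        (h.summable_coeff.mul_right M)
      obtain ⟨s, hs, hs'⟩ := hrow j
      exact (tsum_eq_sum hs).trans_le hs'
  calc ∑' x, T.m x * (u x * g x) = ∑' x, ∑' j, c j * (T.m x * (u x * a j x)) := by
        refine tsum_congr fun x => ?_
        rw [← (h.hasSum x).tsum_eq, ← tsum_mul_left, ← tsum_mul_left]
        exact tsum_congr fun j => by ring
    _ = ∑' j, ∑' x, c j * (T.m x * (u x * a j x)) := hsum.tsum_comm
    _ = _ := tsum_congr fun j => tsum_mul_left

theorem integralOn_univ_mul (f g : V → ℂ) :
    T.integralOn Set.univ (fun x => f x * g x) = ∑' x, T.m x * (f x * g x) := by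
  rw [integralOn, tsum_univ fun x => T.m x • (f x * g x)]
  simp only [Complex.real_smul]

theorem MemBMO.norm_tsum_mul_le {f : V → ℂ} (hf : T.MemBMO β f) {g : Hardy T β}
    (hg : g ∈ Hardy.finSubspace T β) :
    ‖∑' x, T.m x * (f x * g.toFun x)‖ ≤ 2 * (T.bmoNorm β f).toReal * ‖g‖ := by
  obtain ⟨s, hs, -⟩ := Hardy.exists_finset_of_mem_finSubspace hg
  -- A crude height at which truncation does not change `f` on the support of `g`.
  set M := ∑ x ∈ s, ‖f x‖
  have hM : 0 ≤ M := Finset.sum_nonneg fun _ _ => norm_nonneg _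
  have htrunc : ∑' x, T.m x * (f x * g.toFun x) =
      ∑' x, T.m x * (Complex.clamp M (f x) * g.toFun x) := by
    refine tsum_congr fun x => ?_
    by_cases hx : x ∈ s
    · rw [Complex.clamp_eq_self
        (Finset.single_le_sum (f := fun x => ‖f x‖) (fun _ _ => norm_nonneg _) hx)]
    · rw [hs x hx, mul_zero, mul_zero, mul_zero, mul_zero]
  set B := (T.bmoNorm β f).toReal
  have hB : 0 ≤ B := ENNReal.toReal_nonneg
  have key : ∀ t ∈ g.coeffSums, ‖∑' x, T.m x * (f x * g.toFun x)‖ ≤ 2 * B * t := by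
    rintro t ⟨c, a, h, rfl⟩
    rw [htrunc, h.tsum_bounded_mul fun x => Complex.norm_clamp_le hM (f x), mul_comm]
    refine tsum_of_norm_bounded (h.summable_coeff.hasSum.mul_right (2 * B)) fun j => ?_
    rw [norm_mul]
    exact mul_le_mul_of_nonneg_left ((h.isAtom j).norm_tsum_comp_mul_le hf zero_le_two
      (Complex.norm_clamp_sub_clamp_le M)) (norm_nonneg _)
  rcases hB.eq_or_lt with hB' | hB'
  · obtain ⟨t, ht⟩ := Hardy.coeffSums_nonempty g
    have := key t ht
    rw [← hB'] at this ⊢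
    simpa using this
  · rw [← div_le_iff₀' (by positivity), Hardy.norm_def]
    refine le_csInf (Hardy.coeffSums_nonempty g) fun t ht => ?_
    rw [div_le_iff₀' (by positivity)]
    exact key t ht

variable (T β) in
/-- The functional `g ↦ ∫_V f g dm` on `H¹_fin(m)`. -/
noncomputable def pairing (f : V → ℂ) : Hardy.finSubmodule T β →ₗ[ℂ] ℂ where
  toFun g := ∑' x, T.m x * (f x * (g : Hardy T β).toFun x)
  map_add' g h := by
    have hsum : ∀ g : Hardy.finSubmodule T β,
        Summable fun x => T.m x * (f x * (g : Hardy T β).toFun x) := by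
      intro g
      obtain ⟨s, hs, -⟩ := Hardy.exists_finset_of_mem_finSubspace
        (g := (g : Hardy T β)) (Hardy.coe_finSubmodule ▸ g.2)
      exact summable_of_ne_finset_zero (s := s) fun x hx => by rw [hs x hx, mul_zero, mul_zero]
    rw [← (hsum g).tsum_add (hsum h)]
    refine tsum_congr fun x => ?_
    rw [Submodule.coe_add, Hardy.add_toFun]
    ring
  map_smul' z g := by
    rw [RingHom.id_apply, smul_eq_mul, ← tsum_mul_left]
    refine tsum_congr fun x => ?_
    rw [Submodule.coe_smul, Hardy.smul_toFun]
    ring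

theorem Represents.unique {f : V → ℂ} {l l' : Hardy T β →L[ℂ] ℂ} (h : T.Represents f l)
    (h' : T.Represents f l') : l' = l := by
  refine DFunLike.coe_injective
    (Continuous.ext_on Hardy.dense_finSubspace l'.continuous l.continuous fun g hg => ?_)
  rw [h g hg, h' g hg]

theorem MemBMO.exists_represents {f : V → ℂ} (hf : T.MemBMO β f) :
    ∃ l : Hardy T β →L[ℂ] ℂ, T.Represents f l ∧ ‖l‖ ≤ 2 * (T.bmoNorm β f).toReal := by
  have hdense : DenseRange (Hardy.finSubmodule T β).subtype := by
    rw [DenseRange, ← LinearMap.coe_range, Submodule.range_subtype, Hardy.coe_finSubmodule]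
    exact Hardy.dense_finSubspace
  have hbound : ∀ g : Hardy.finSubmodule T β, ‖T.pairing β f g‖ ≤
      2 * (T.bmoNorm β f).toReal * ‖(Hardy.finSubmodule T β).subtype g‖ := fun g =>
    hf.norm_tsum_mul_le (Hardy.coe_finSubmodule ▸ g.2)
  refine ⟨(T.pairing β f).extendOfNorm (Hardy.finSubmodule T β).subtype, fun g hg => ?_,
    LinearMap.opNorm_extendOfNorm_le hdense (by positivity) hbound⟩
  rw [← Hardy.coe_finSubmodule] at hg
  rw [integralOn_univ_mul]
  exact LinearMap.extendOfNorm_eq hdense ⟨_, hbound⟩ ⟨g, hg⟩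

end FlowTree

/-! ### Representing functionals by BMO functions -/

namespace FlowTree

variable {V : Type*} {T : FlowTree V} {β : ℝ}

/-- A bounded function with vanishing integral on an admissible trapezoid is a multiple of an
atom. -/
theorem IsAtom.of_bounded {g : V → ℂ} {s : Finset V} (hs : T.IsAdmissible β (s : Set V))
    {M : ℝ} (hM : 0 < M) (h₁ : ∀ x ∉ s, g x = 0) (h₂ : ∀ x, ‖g x‖ ≤ M)
    (h₃ : ∑ x ∈ s, T.m x * g x = 0) :
    T.IsAtom β fun x => ((T.mass (s : Set V) * M : ℝ) : ℂ)⁻¹ * g x := by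
  refine IsAtom.of_finset hs (fun x hx => by rw [h₁ x hx, mul_zero]) (fun x => ?_) ?_
  · have hm := T.mass_nonneg (s : Set V)
    rw [norm_mul, norm_inv, Complex.norm_of_nonneg (mul_nonneg hm hM.le), mul_inv, mul_assoc]
    refine mul_le_of_le_one_right (inv_nonneg.mpr hm) ?_
    rw [inv_mul_le_iff₀ hM, mul_one]
    exact h₂ x
  · simp only [mul_left_comm (T.m _ : ℂ)]
    rw [← Finset.mul_sum, h₃, mul_zero]

theorem isAdmissible_trapezoid_one_three (hβ : 3 ≤ β) (x : V) :
    T.IsAdmissible β (T.trapezoid x 1 3) :=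
  Or.inr ⟨x, 1, 3, le_rfl, by norm_num, by norm_num, by norm_num [hβ], rfl⟩

/-- The trapezoid with h' = 1, h'' = 3 rooted at the grandparent of the lower vertex consists of the
two levels below its root, so it contains both vertices. -/
theorem exists_admissible_of_adj (hβ : 3 ≤ β) {x y : V} (h : T.graph.Adj x y) :
    ∃ s : Finset V, T.IsAdmissible β (s : Set V) ∧ x ∈ s ∧ y ∈ s := by
  wlog hl : T.level y = T.level x + 1 generalizing x y
  · obtain ⟨s, hs, hy, hx⟩ := this h.symm (by
      rcases T.level_eq_or_of_adj h with h' | h'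
      · exact absurd h' hl
      · omega)
    exact ⟨s, hs, hx, hy⟩
  obtain ⟨z, hz, hlz⟩ := T.exists_parent y
  have hadm := isAdmissible_trapezoid_one_three (T := T) hβ z
  have hyz := SimpleGraph.dist_eq_one_iff_adj.mpr hz
  have hxy := SimpleGraph.dist_eq_one_iff_adj.mpr h
  have hxz := T.dist_triangle x y z
  have hzx := T.level_sub_le z x
  rw [T.graph.dist_comm] at hzx
  obtain ⟨s, hs⟩ := (T.finite_of_isAdmissible hadm).exists_finset_coe
  refine ⟨s, hs ▸ hadm, ?_, ?_⟩
  · rw [← Finset.mem_coe, hs]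
    refine ⟨?_, by push_cast; omega, by push_cast; omega⟩
    change T.level z - T.level x = T.graph.dist x z
    omega
  · rw [← Finset.mem_coe, hs]
    refine ⟨?_, by push_cast; omega, by push_cast; omega⟩
    change T.level z - T.level y = T.graph.dist y z
    omega

open Classical in
variable (T) in
/-- The point mass at `x`, as a density with respect to `m`. -/
noncomputable def dirac (x : V) : V → ℂ := fun y => if y = x then (T.m x : ℂ)⁻¹ else 0

theorem dirac_of_ne {x y : V} (h : y ≠ x) : T.dirac x y = 0 := if_neg h

theorem dirac_self (x : V) : T.dirac x x = (T.m x : ℂ)⁻¹ := if_pos rfl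

theorem m_mul_dirac (x y : V) [Decidable (y = x)] :
    (T.m y : ℂ) * T.dirac x y = if y = x then 1 else 0 := by
  split_ifs with h
  · subst h
    rw [dirac_self, mul_inv_cancel₀ (by exact_mod_cast (T.m_pos y).ne')]
  · rw [dirac_of_ne h, mul_zero]

theorem norm_dirac_le (x y : V) : ‖T.dirac x y‖ ≤ (T.m x)⁻¹ := by
  have hx := (T.m_pos x).le
  by_cases h : y = x
  · subst h
    rw [dirac_self, norm_inv, Complex.norm_of_nonneg hx]
  · rw [dirac_of_ne h, norm_zero]
    exact inv_nonneg.mpr hx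

theorem dirac_sub_dirac_mem (hβ : 3 ≤ β) (x y : V) :
    T.dirac x - T.dirac y ∈ (Hardy.finSubmodule T β).map (Hardy.toFunLinear T β) := by
  classical
  obtain ⟨p⟩ := T.isTree.connected x y
  induction p with
  | nil =>
    rw [sub_self]
    exact Submodule.zero_mem _
  | @cons x z y h _ ih =>
    rw [← sub_add_sub_cancel (T.dirac x) (T.dirac z) (T.dirac y)]
    refine Submodule.add_mem _ ?_ ih
    obtain ⟨s, hs, hx, hz⟩ := exists_admissible_of_adj hβ h
    have hM : 0 < (T.m x)⁻¹ + (T.m z)⁻¹ :=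
      add_pos (inv_pos.mpr (T.m_pos x)) (inv_pos.mpr (T.m_pos z))
    have ha := IsAtom.of_bounded (g := T.dirac x - T.dirac z) hs hM (fun w hw => ?_) (fun w =>
      (norm_sub_le _ _).trans (add_le_add (norm_dirac_le x w) (norm_dirac_le z w))) ?_
    · have hne : ((T.mass (s : Set V) * ((T.m x)⁻¹ + (T.m z)⁻¹) : ℝ) : ℂ) ≠ 0 := by
        exact_mod_cast (mul_pos (mass_pos ⟨x, hx⟩) hM).ne'
      refine ⟨((T.mass (s : Set V) * ((T.m x)⁻¹ + (T.m z)⁻¹) : ℝ) : ℂ) • Hardy.ofAtom ha,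
        Submodule.smul_mem _ _ (Submodule.subset_span ha), funext fun w => ?_⟩
      rw [Hardy.toFunLinear_apply, Hardy.smul_toFun, Hardy.ofAtom_toFun, mul_inv_cancel_left₀ hne]
    · rw [Pi.sub_apply, dirac_of_ne (ne_of_mem_of_not_mem hx hw).symm,
        dirac_of_ne (ne_of_mem_of_not_mem hz hw).symm, sub_zero]
    · simp only [Pi.sub_apply, mul_sub, m_mul_dirac, Finset.sum_sub_distrib, Finset.sum_ite_eq',
        if_pos hx, if_pos hz, sub_self]

theorem exists_represents (hβ : 3 ≤ β) (l : Hardy T β →L[ℂ] ℂ) :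
    ∃ f : V → ℂ, T.Represents f l := by
  classical
  choose e _ he using fun x => dirac_sub_dirac_mem (T := T) hβ x (T.ray 0)
  have he' : ∀ x y, (e x).toFun y = T.dirac x y - T.dirac (T.ray 0) y := fun x y =>
    congrFun (he x) y
  refine ⟨fun x => l (e x), fun g hg => ?_⟩
  obtain ⟨s, hs, hint⟩ := Hardy.exists_finset_of_mem_finSubspace hg
  rw [T.integralOn_univ_eq_sum (s := s) fun x hx => by rw [hs x hx, mul_zero]]
  -- The point masses at the origin cancel because `g` has mean zero.
  have hg' : g = ∑ x ∈ s, ((T.m x : ℂ) * g.toFun x) • e x := by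
    refine Hardy.ext fun y => ?_
    simp only [Hardy.sum_toFun, Hardy.smul_toFun, he', mul_sub, Finset.sum_sub_distrib]
    rw [← Finset.sum_mul, hint, zero_mul, sub_zero]
    have hy : (T.m y : ℂ) ≠ 0 := by exact_mod_cast (T.m_pos y).ne'
    apply mul_left_cancel₀ hy
    simp only [Finset.mul_sum, mul_left_comm (T.m y : ℂ) (_ * _), m_mul_dirac, mul_ite, mul_one,
      mul_zero, Finset.sum_ite_eq]
    split_ifs with h
    · rfl
    · rw [hs y h, mul_zero]
  conv_lhs => rw [hg', map_sum]
  refine Finset.sum_congr rfl fun x _ => ?_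
  rw [map_smul, smul_eq_mul, Complex.real_smul]
  ring

theorem norm_average_le {s : Finset V} {u : V → ℂ} (hu : ∀ x, ‖u x‖ ≤ 1) :
    ‖T.average s u‖ ≤ 1 := by
  rcases s.eq_empty_or_nonempty with rfl | hs
  · rw [average, integralOn_coe, Finset.sum_empty, smul_zero, norm_zero]
    exact zero_le_one
  · have h : ‖(T.mass (s : Set V) : ℂ) * T.average s u‖ ≤ T.mass (s : Set V) := by
      rw [mass_mul_average, mass_coe]
      refine norm_sum_le_of_le s fun x _ => ?_
      rw [norm_mul, Complex.norm_of_nonneg (T.m_pos x).le]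
      exact mul_le_of_le_one_right (T.m_pos x).le (hu x)
    rw [norm_mul, Complex.norm_of_nonneg (T.mass_nonneg _)] at h
    exact le_of_mul_le_mul_left (h.trans_eq (mul_one _).symm) (mass_pos hs)

theorem sum_mul_sub_average (s : Finset V) (f : V → ℂ) :
    ∑ x ∈ s, (T.m x : ℂ) * (f x - T.average s f) = 0 := by
  simp only [mul_sub, Finset.sum_sub_distrib]
  rw [← Finset.sum_mul, ← mass_mul_average, mass_coe]
  push_cast
  ring

/-- With |u| ≤ 1 and u(f - f_R) = |f - f_R|, the function u - u_R on R has mean zero and is bounded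
by 2, so it is 2m(R) times an atom. -/
theorem Represents.sum_norm_sub_average_le {f : V → ℂ} {l : Hardy T β →L[ℂ] ℂ}
    (h : T.Represents f l) {s : Finset V} (hs : T.IsAdmissible β (s : Set V)) (hne : s.Nonempty) :
    ∑ x ∈ s, T.m x * ‖f x - T.average s f‖ ≤ T.mass (s : Set V) * 2 * ‖l‖ := by
  classical
  choose u hu hu' using fun x => Complex.exists_norm_le_one_mul_eq_norm (f x - T.average s f)
  let g : V → ℂ := fun x => if x ∈ s then u x - T.average s u else 0
  have hgs : ∀ x ∈ s, g x = u x - T.average s u := fun x hx => if_pos hx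
  have hgo : ∀ x ∉ s, g x = 0 := fun x hx => if_neg hx
  have hgint : ∑ x ∈ s, (T.m x : ℂ) * g x = 0 := by
    rw [← sum_mul_sub_average s u]
    exact Finset.sum_congr rfl fun x hx => by rw [hgs x hx]
  have ha := IsAtom.of_bounded hs two_pos hgo (fun x => ?_) hgint
  · have hpos : 0 < T.mass (s : Set V) * 2 := mul_pos (mass_pos hne) two_pos
    have hl := l.le_of_opNorm_le_of_le le_rfl (Hardy.norm_ofAtom_le ha)
    have hmem : Hardy.ofAtom ha ∈ Hardy.finSubspace T β := by
      rw [← Hardy.coe_finSubmodule]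
      exact Submodule.subset_span ha
    -- On R, f g = |f - f_R| + f_R g - u_R (f - f_R), and the last two terms integrate to zero.
    have hfg : ∑ x ∈ s, (T.m x : ℂ) * (f x * g x) =
        ((∑ x ∈ s, T.m x * ‖f x - T.average s f‖ : ℝ) : ℂ) := by
      calc ∑ x ∈ s, (T.m x : ℂ) * (f x * g x)
          = ∑ x ∈ s, ((T.m x : ℂ) * ‖f x - T.average s f‖ + T.average s f * (T.m x * g x) -
              T.average s u * (T.m x * (f x - T.average s f))) := by
            refine Finset.sum_congr rfl fun x hx => ?_
            rw [hgs x hx, ← hu' x]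
            ring
        _ = _ := by
            rw [Finset.sum_sub_distrib, Finset.sum_add_distrib, ← Finset.mul_sum, ← Finset.mul_sum,
              hgint, sum_mul_sub_average]
            push_cast
            ring
    rw [h _ hmem, T.integralOn_univ_eq_sum (s := s) fun x hx => by
      rw [Hardy.ofAtom_toFun, hgo x hx, mul_zero, mul_zero]] at hl
    simp only [Hardy.ofAtom_toFun, Complex.real_smul, mul_left_comm _ (_⁻¹ : ℂ)] at hl
    rw [← Finset.mul_sum, hfg, norm_mul, norm_inv, Complex.norm_of_nonneg hpos.le,
      Complex.norm_of_nonneg (Finset.sum_nonneg fun x _ => mul_nonneg (T.m_pos x).le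
        (norm_nonneg _)), inv_mul_le_iff₀ hpos, mul_one] at hl
    exact hl
  · by_cases hx : x ∈ s
    · rw [hgs x hx]
      refine (norm_sub_le _ _).trans ?_
      rw [← one_add_one_eq_two]
      exact add_le_add (hu x) (norm_average_le hu)
    · rw [hgo x hx, norm_zero]
      exact zero_le_two

theorem Represents.bmoNorm_le {f : V → ℂ} {l : Hardy T β →L[ℂ] ℂ} (h : T.Represents f l) :
    T.bmoNorm β f ≤ ENNReal.ofReal (2 * ‖l‖) := by
  refine iSup₂_le fun R hR => ENNReal.ofReal_le_ofReal ?_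
  lift R to Finset V using T.finite_of_isAdmissible hR
  rw [integralOn_coe]
  rcases R.eq_empty_or_nonempty with rfl | hne
  · simp
  · rw [inv_mul_le_iff₀ (mass_pos hne), ← mul_assoc]
    exact h.sum_norm_sub_average_le hR hne

end FlowTree

theorem mainTheorem1 {V : Type*} (T : FlowTree V) (β : ℝ) (hβ : 12 ≤ β) :
    Dense (FlowTree.Hardy.finSubspace T β) ∧
    (∃ C : ℝ, 0 < C ∧ ∀ f : V → ℂ, T.MemBMO β f →
      ∃ l : FlowTree.Hardy T β →L[ℂ] ℂ, T.Represents f l ∧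
        (∀ l' : FlowTree.Hardy T β →L[ℂ] ℂ, T.Represents f l' → l' = l) ∧
        ‖l‖ ≤ C * (T.bmoNorm β f).toReal) ∧
    (∃ C : ℝ, 0 < C ∧ ∀ l : FlowTree.Hardy T β →L[ℂ] ℂ,
      ∃ f : V → ℂ, T.MemBMO β f ∧ T.Represents f l ∧
        (T.bmoNorm β f).toReal ≤ C * ‖l‖) := by
  refine ⟨FlowTree.Hardy.dense_finSubspace, ⟨2, two_pos, fun f hf => ?_⟩,
    ⟨2, two_pos, fun l => ?_⟩⟩
  · obtain ⟨l, hl, hnorm⟩ := hf.exists_represents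
    exact ⟨l, hl, fun l' hl' => hl.unique hl', hnorm⟩
  · obtain ⟨f, hf⟩ := FlowTree.exists_represents (by linarith) l
    have hle := hf.bmoNorm_le
    exact ⟨f, hle.trans_lt ENNReal.ofReal_lt_top, hf,
      ENNReal.toReal_le_of_le_ofReal (by positivity) hle⟩
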